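/- Let $\mathscr{R}$ be a divisible, archimedean, conditionally complete bipotent semifield without zero, i.e. a totally ordered abelian group $(\mathscr{R},\cdot,\le)$ with sum $a\dotplus b=\max(a,b)$ that is divisible, archimedean and conditionally complete (for example $(\mathbb{R}_{>0},\max,\cdot)$), and let $n\ge 0$. Let $\mathscr{R}(x_1,\dots,x_n)$ be the semifield of all functions $\mathscr{R}^n\to\mathscr{R}$ of the form $p/q$, where $p,q$ are polynomial functions, that is, finite nonempty sums of monomials $\alpha x_1^{e_1}\cdots x_n^{e_n}$ with $\alpha\in\mathscr{R}$, $e_i\in\mathbb{Z}_{\ge 0}$; the operations are pointwise. A kernel of a semifield $\mathbb{S}$ (with commutative multiplication) is a subgroup $K$ of $(\mathbb{S},\cdot)$ such that $xa\dotplus yb\in K$ whenever $a,b\in K$, $x,y\in\mathbb{S}$ and $x\dotplus y=1$. For $A\subseteq\mathbb{S}$ let $\langle A\rangle$ be the smallest kernel of $\mathbb{S}$ containing $A$; a kernel of the form $\langle a\rangle=\langle\{a\}\rangle$ with $a\in\mathbb{S}$ is called principal, and $a$ is called a generator of it. Let $\langle\mathscr{R}\rangle$ be the kernel of $\mathscr{R}(x_1,\dots,x_n)$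 generated by the constant functions (equivalently, when $\mathscr R\ne\{1\}$, by any one constant $\alpha\neq 1$); it is itself a subsemifield of $\mathscr{R}(x_1,\dots,x_n)$. For $A\subseteq\mathscr{R}(x_1,\dots,x_n)$ and $Z\subseteq\mathscr{R}^n$ put $$\mathrm{Skel}(A)=\{a\in\mathscr{R}^n : f(a)=1\ \text{for all } f\in A\},\qquad \mathrm{Ker}(Z)=\{f\in\mathscr{R}(x_1,\dots,x_n) : f(a)=1\ \text{for all } a\in Z\},$$ and write $\mathrm{Skel}(f)=\mathrm{Skel}(\{f\})$. A principal skeleton is a set $\mathrm{Skel}(f)$ with $f\in\mathscr{R}(x_1,\dots,x_n)$. Then: 1. The maps $Z\mapsto \mathrm{Ker}(Z)\cap\langle\mathscr{R}\rangle$ and $K\mapsto\mathrm{Skel}(K)$ are mutually inverse bijections between the set of principal skeletons in $\mathscr{R}^n$ and the set of principal kernels of the semifield $\langle\mathscr{R}\rangle$. They reverse order: for principal skeletons $Z,Z'$ one has $Z\subseteq Z'$ if and only if $\mathrm{Ker}(Z')\cap\langle\mathscr{R}\rangle\subseteq\mathrm{Ker}(Z)\cap\langle\mathscr{R}\rangle$.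 2. Let $f,h\in\langle\mathscr{R}\rangle$, let $\langle f\rangle$ and $\langle h\rangle$ be the kernels of the semifield $\langle\mathscr{R}\rangle$ that they generate, and suppose that $h\in\langle f\rangle$ and $\mathrm{Skel}(h)=\mathrm{Skel}(f)$. Then $\langle h\rangle=\langle f\rangle$. Likewise, if $f,h\in\mathscr{R}(x_1,\dots,x_n)$ generate the kernels $\langle f\rangle,\langle h\rangle$ of $\mathscr{R}(x_1,\dots,x_n)$, and $\langle f\rangle\subseteq\langle\mathscr{R}\rangle$, $h\in\langle f\rangle$ and $\mathrm{Skel}(h)=\mathrm{Skel}(f)$, then $\langle h\rangle=\langle f\rangle$. -/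

import Mathlib

section Semifields

/-!
Idempotent semifields (commutative, without a zero element) are the same thing as
lattice-ordered abelian groups: the semifield sum is the join `⊔`, the product is the group
product, and the natural order `a ≤ b ↔ a ⊔ b = b` is the given one.  A bipotent semifield is one
whose order is total.  So an idempotent semifield is given here by
`[CommGroup S] [SemilatticeSup S] [IsOrderedMonoid S]`.
-/

/-- A subsemifield of an idempotent semifield: a subgroup that is closed under sums. -/
structure Subsemifield (S : Type*) [CommGroup S] [SemilatticeSup S] [IsOrderedMonoid S]
    extends Subgroup S where
  sup_mem' : ∀ {a b : S}, a ∈ carrier → b ∈ carrier → a ⊔ b ∈ carrier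

/-- A kernel of an idempotent semifield: a (normal) subgroup `K` such that
`x * a ⊔ y * b ∈ K` whenever `a, b ∈ K` and `x ⊔ y = 1`. -/
structure SemifieldKernel (S : Type*) [CommGroup S] [SemilatticeSup S] [IsOrderedMonoid S]
    extends Subgroup S where
  convex' : ∀ {x y a b : S}, x ⊔ y = 1 → a ∈ carrier → b ∈ carrier → x * a ⊔ y * b ∈ carrier

variable {S : Type*} [CommGroup S] [SemilatticeSup S] [IsOrderedMonoid S]

instance Subsemifield.instSetLike : SetLike (Subsemifield S) S where
  coe U := U.carrier
  coe_injective U V h := by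
    rcases U with ⟨U, _⟩
    rcases V with ⟨V, _⟩
    have : U = V := SetLike.coe_injective h
    subst this
    rfl

instance Subsemifield.instSubgroupClass : SubgroupClass (Subsemifield S) S where
  mul_mem {U} := U.mul_mem'
  one_mem U := U.one_mem'
  inv_mem {U} := U.inv_mem'

/-- A subsemifield is a semifield, with the induced operations. -/
instance Subsemifield.instSemilatticeSup (U : Subsemifield S) : SemilatticeSup U :=
  Subtype.semilatticeSup fun _ _ ha hb => U.sup_mem' ha hb

instance Subsemifield.instIsOrderedMonoid (U : Subsemifield S) : IsOrderedMonoid U where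
  mul_le_mul_left a b h c :=
    show (a : S) * (c : S) ≤ (b : S) * (c : S) from mul_le_mul_left (show (a : S) ≤ (b : S) from h) _

instance SemifieldKernel.instSetLike : SetLike (SemifieldKernel S) S where
  coe K := K.carrier
  coe_injective K L h := by
    rcases K with ⟨K, _⟩
    rcases L with ⟨L, _⟩
    have : K = L := SetLike.coe_injective h
    subst this
    rfl

/-- The kernel `⟨A⟩` generated by a subset `A`: the intersection of all kernels containing `A`. -/
def SemifieldKernel.generate (A : Set S) : SemifieldKernel S where
  carrier := {a | ∀ K : SemifieldKernel S, A ⊆ (K : Set S) → a ∈ K}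
  mul_mem' ha hb K hK := K.mul_mem' (ha K hK) (hb K hK)
  one_mem' K _ := K.one_mem'
  inv_mem' ha K hK := K.inv_mem' (ha K hK)
  convex' hxy ha hb K hK := K.convex' hxy (ha K hK) (hb K hK)

/-- A principal kernel is a kernel generated by one element. -/
def SemifieldKernel.IsPrincipal (K : SemifieldKernel S) : Prop :=
  ∃ a : S, K = SemifieldKernel.generate {a}

/-- A kernel of an idempotent semifield is a subsemifield. -/
def SemifieldKernel.toSubsemifield (K : SemifieldKernel S) : Subsemifield S where
  toSubgroup := K.toSubgroup
  sup_mem' ha hb := by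
    have h := K.convex' (x := 1) (y := 1) (sup_idem (1 : S)) ha hb
    simpa using h

end Semifields

section RationalFunctions

variable {R : Type*} [CommGroup R] [LinearOrder R] {n : ℕ}

/-- The monomial function `x ↦ α * x₁ ^ e₁ * ⋯ * xₙ ^ eₙ`. -/
def monomialFun (α : R) (e : Fin n → ℕ) : (Fin n → R) → R :=
  fun x => α * ∏ j, x j ^ e j

/-- Polynomial functions over the bipotent semifield `R` (whose sum is the maximum):
finite nonempty sums of monomials. -/
def IsPolynomialFun (p : (Fin n → R) → R) : Prop :=
  ∃ (s : Finset (R × (Fin n → ℕ))) (hs : s.Nonempty),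
    ∀ x, p x = s.sup' hs fun m => monomialFun m.1 m.2 x

theorem IsPolynomialFun.monomial (α : R) (e : Fin n → ℕ) :
    IsPolynomialFun (monomialFun α e) :=
  ⟨{(α, e)}, Finset.singleton_nonempty _, fun x => by simp⟩

theorem IsPolynomialFun.sup {p q : (Fin n → R) → R} (hp : IsPolynomialFun p)
    (hq : IsPolynomialFun q) : IsPolynomialFun (p ⊔ q) := by
  classical
  obtain ⟨s, hs, hp⟩ := hp
  obtain ⟨t, ht, hq⟩ := hq
  refine ⟨s ∪ t, hs.mono Finset.subset_union_left, fun x => ?_⟩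
  rw [Finset.sup'_union hs ht, ← hp, ← hq, Pi.sup_apply]

theorem IsPolynomialFun.mul [IsOrderedMonoid R] {p q : (Fin n → R) → R} (hp : IsPolynomialFun p)
    (hq : IsPolynomialFun q) : IsPolynomialFun (p * q) := by
  classical
  obtain ⟨s, hs, hp⟩ := hp
  obtain ⟨t, ht, hq⟩ := hq
  refine ⟨(s ×ˢ t).image fun m => (m.1.1 * m.2.1, m.1.2 + m.2.2), (hs.product ht).image _,
    fun x => ?_⟩
  have key : ∀ m m' : R × (Fin n → ℕ), monomialFun (m.1 * m'.1) (m.2 + m'.2) x =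
      monomialFun m.1 m.2 x * monomialFun m'.1 m'.2 x := by
    intro m m'
    simp only [monomialFun, Pi.add_apply, pow_add, Finset.prod_mul_distrib]
    exact mul_mul_mul_comm _ _ _ _
  rw [Pi.mul_apply, hp, hq, Finset.sup'_image]
  apply le_antisymm
  · obtain ⟨m, hm, hm'⟩ := Finset.exists_mem_eq_sup' hs fun m => monomialFun m.1 m.2 x
    obtain ⟨k, hk, hk'⟩ := Finset.exists_mem_eq_sup' ht fun m => monomialFun m.1 m.2 x
    rw [hm', hk', ← key]
    exact Finset.le_sup' (f := (fun m : R × (Fin n → ℕ) => monomialFun m.1 m.2 x) ∘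
      fun m : (R × (Fin n → ℕ)) × (R × (Fin n → ℕ)) => (m.1.1 * m.2.1, m.1.2 + m.2.2))
      (Finset.mk_mem_product hm hk)
  · refine Finset.sup'_le _ _ fun m hm => ?_
    rw [Finset.mem_product] at hm
    simp only [Function.comp_apply]
    rw [key]
    exact mul_le_mul' (Finset.le_sup' (fun m => monomialFun m.1 m.2 x) hm.1)
      (Finset.le_sup' (fun m => monomialFun m.1 m.2 x) hm.2)

variable [IsOrderedMonoid R]

variable (R n) in
/-- The semifield of fractions `R(x₁, …, xₙ)`, as a subsemifield of the semifield of all functions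
`Rⁿ → R` with pointwise operations: the quotients of polynomial functions. -/
def RationalFun : Subsemifield ((Fin n → R) → R) where
  carrier := {f | ∃ p q, IsPolynomialFun p ∧ IsPolynomialFun q ∧ f = p / q}
  mul_mem' := by
    rintro _ _ ⟨p, q, hp, hq, rfl⟩ ⟨p', q', hp', hq', rfl⟩
    exact ⟨p * p', q * q', hp.mul hp', hq.mul hq', div_mul_div_comm _ _ _ _⟩
  one_mem' := ⟨_, _, .monomial 1 0, .monomial 1 0, (div_self' _).symm⟩
  inv_mem' := by
    rintro _ ⟨p, q, hp, hq, rfl⟩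
    exact ⟨q, p, hq, hp, inv_div _ _⟩
  sup_mem' := by
    rintro _ _ ⟨p, q, hp, hq, rfl⟩ ⟨p', q', hp', hq', rfl⟩
    refine ⟨p * q' ⊔ p' * q, q * q', (hp.mul hq').sup (hp'.mul hq), hq.mul hq', ?_⟩
    funext x
    simp only [Pi.sup_apply, Pi.div_apply, Pi.mul_apply, Pi.inv_apply, div_eq_mul_inv, sup_mul]
    congr 1
    · rw [mul_inv, mul_mul_mul_comm, mul_inv_cancel, mul_one]
    · rw [mul_inv, mul_comm (q x)⁻¹, mul_mul_mul_comm, mul_inv_cancel, mul_one]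

variable (n) in
/-- The constant function `α`, as an element of `R(x₁, …, xₙ)`. -/
def RationalFun.const (α : R) : RationalFun R n :=
  ⟨fun _ => α, monomialFun α 0, monomialFun 1 0, .monomial _ _, .monomial _ _, by
    funext x
    simp [monomialFun]⟩

variable (R n) in
/-- The kernel `⟨R⟩` of `R(x₁, …, xₙ)` generated by the constants. -/
def constKernel : SemifieldKernel (RationalFun R n) :=
  SemifieldKernel.generate (Set.range (RationalFun.const n))

variable (R n) in
/-- The kernel `⟨R⟩`, regarded as a semifield in its own right. -/
abbrev BoundedFun : Subsemifield (RationalFun R n) :=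
  (constKernel R n).toSubsemifield

/-- The skeleton of a set `A` of rational functions: the points where all of them equal `1`. -/
def Skel (A : Set (RationalFun R n)) : Set (Fin n → R) :=
  {x | ∀ f ∈ A, (f : (Fin n → R) → R) x = 1}

/-- Principal skeletons: the skeletons of single rational functions. -/
def IsPrincipalSkeleton (Z : Set (Fin n → R)) : Prop :=
  ∃ f : RationalFun R n, Z = Skel {f}

/-- `Ker(Z)`: the set of all rational functions that equal `1` on `Z`. -/
def Ker (Z : Set (Fin n → R)) : Set (RationalFun R n) :=
  {f | ∀ x ∈ Z, (f : (Fin n → R) → R) x = 1}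

/-- `Ker(Z) ∩ ⟨R⟩`, as a subset of `⟨R⟩`. -/
def boundedKer (Z : Set (Fin n → R)) : Set (BoundedFun R n) :=
  {f | (f : RationalFun R n) ∈ Ker Z}

/-- The skeleton of a kernel of `⟨R⟩`, viewed as a set of rational functions. -/
def kernelSkel (K : SemifieldKernel (BoundedFun R n)) : Set (Fin n → R) :=
  Skel ((fun f : BoundedFun R n => (f : RationalFun R n)) '' (K : Set (BoundedFun R n)))

end RationalFunctions

/-! Kernels are order-convex, so with |f| = f ⊔ f⁻¹ ⊔ 1 an element g lies in ⟨f⟩ iff |g| ≤ |f|^m for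
some m, and ⟨R⟩ consists of the bounded rational functions. Everything then rests on a
Nullstellensatz: if f is bounded and Skel(h) ⊆ Skel(f), then |f| ≤ |h|^m for some m
(`RationalFun.exists_le_pow`). Boundedness is essential: x ⊔ x⁻¹ is not dominated by a power of its
truncation at a constant.

In additive notation |f| and |h| are piecewise affine with integer slopes. On a common polyhedral
piece they are affine functions a and b, and the system "piece, b ≤ 0, a > 0" has no solution.
Motzkin's transposition theorem yields a constant c ≤ μb - νa on the piece, with μ, ν natural
numbers. If ν > 0, then c ≥ 0 and a ≤ νa ≤ μb. If ν = 0, then c > 0 bounds μb from below, and the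
archimedean property lets a multiple of c exceed the bound of a. The largest multiplier over the
finitely many pieces gives m.

So a principal kernel of ⟨R⟩ is determined by its skeleton. Truncation shows that every principal
skeleton arises in this way. -/

section FourierMotzkin

/-! ### Fourier–Motzkin elimination with integer slopes -/

variable {M : Type*} [AddCommGroup M] {n : ℕ}

/-- The value at `x` of the affine function with integer slopes `a.1` and constant term `a.2`. -/
def affineEval (a : (Fin n → ℤ) × M) (x : Fin n → M) : M :=
  ∑ j, a.1 j • x j + a.2

theorem affineEval_add (a b : (Fin n → ℤ) × M) (x : Fin n → M) :
    affineEval (a + b) x = affineEval a x + affineEval b x := by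
  simp only [affineEval, Prod.fst_add, Prod.snd_add, Pi.add_apply, add_smul,
    Finset.sum_add_distrib]
  abel

theorem affineEval_neg (a : (Fin n → ℤ) × M) (x : Fin n → M) :
    affineEval (-a) x = -affineEval a x := by
  simp only [affineEval, Prod.fst_neg, Prod.snd_neg, Pi.neg_apply, neg_smul,
    Finset.sum_neg_distrib]
  abel

theorem affineEval_sub (a b : (Fin n → ℤ) × M) (x : Fin n → M) :
    affineEval (a - b) x = affineEval a x - affineEval b x := by
  rw [sub_eq_add_neg, affineEval_add, affineEval_neg, sub_eq_add_neg]

theorem affineEval_nsmul (k : ℕ) (a : (Fin n → ℤ) × M) (x : Fin n → M) :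
    affineEval (k • a) x = k • affineEval a x := by
  induction k with
  | zero => simp [affineEval]
  | succ k ih => rw [succ_nsmul, affineEval_add, ih, succ_nsmul]

theorem affineEval_cons (a : (Fin (n + 1) → ℤ) × M) (t : M) (x : Fin n → M) :
    affineEval a (Fin.cons t x) = a.1 0 • t + affineEval (Fin.tail a.1, a.2) x := by
  simp [affineEval, Fin.sum_univ_succ, Fin.tail, add_assoc]

/-- Forget the slope of the first variable. -/
def affineTail (c : ((Fin (n + 1) → ℤ) × M) × ℕ) : ((Fin n → ℤ) × M) × ℕ :=
  ((Fin.tail c.1.1, c.1.2), c.2)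

/-- Regard an inequality in `n` variables as one in `n + 1` variables. -/
def affineLift : ((Fin n → ℤ) × M) × ℕ →+ ((Fin (n + 1) → ℤ) × M) × ℕ where
  toFun c := ((Fin.cons 0 c.1.1, c.1.2), c.2)
  map_zero' := by
    refine Prod.ext (Prod.ext (funext fun j => ?_) rfl) rfl
    refine Fin.cases ?_ (fun j => ?_) j <;> simp
  map_add' c d := by
    refine Prod.ext (Prod.ext (funext fun j => ?_) rfl) rfl
    refine Fin.cases ?_ (fun j => ?_) j <;> simp

theorem affineLift_affineTail {c : ((Fin (n + 1) → ℤ) × M) × ℕ} (hc : c.1.1 0 = 0) :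
    affineLift (affineTail c) = c := by
  refine Prod.ext (Prod.ext (funext fun j => ?_) rfl) rfl
  refine Fin.cases ?_ (fun j => ?_) j <;> simp [affineLift, affineTail, hc, Fin.tail]

/-- The combination of two inequalities that eliminates the first variable. -/
def affineElim (p q : ((Fin (n + 1) → ℤ) × M) × ℕ) : ((Fin (n + 1) → ℤ) × M) × ℕ :=
  (-q.1.1 0).toNat • p + (p.1.1 0).toNat • q

theorem affineElim_zero {p q : ((Fin (n + 1) → ℤ) × M) × ℕ} (hp : 0 < p.1.1 0)
    (hq : q.1.1 0 < 0) : (affineElim p q).1.1 0 = 0 := by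
  have h1 : ((-q.1.1 0).toNat : ℤ) = -q.1.1 0 := Int.toNat_of_nonneg (by omega)
  have h2 : ((p.1.1 0).toNat : ℤ) = p.1.1 0 := Int.toNat_of_nonneg hp.le
  simp only [affineElim, Prod.fst_add, Prod.smul_fst, Pi.add_apply, Pi.smul_apply]
  rw [nsmul_eq_mul, nsmul_eq_mul, h1, h2]
  ring

variable [LinearOrder M]

/-- The pair `(a, s)` stands for the inequality `a ≤ 0`, which is strict if `s` is positive. -/
def AffineSat (c : ((Fin n → ℤ) × M) × ℕ) (x : Fin n → M) : Prop :=
  affineEval c.1 x ≤ 0 ∧ (0 < c.2 → affineEval c.1 x < 0)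

variable [IsOrderedAddMonoid M]

/-- A finite system of bounds, some of them strict, that are pairwise consistent has a solution. -/
theorem exists_between_of_pairwise {α ι : Type*} [LinearOrder α] [DenselyOrdered α] [NoMinOrder α]
    [NoMaxOrder α] [Nonempty α] {U L : Set ι} (hU : U.Finite) (hL : L.Finite) (u l : ι → α)
    (s : ι → Prop) (h : ∀ p ∈ U, ∀ q ∈ L, l q ≤ u p ∧ (s p ∨ s q → l q < u p)) :
    ∃ t, (∀ p ∈ U, t ≤ u p ∧ (s p → t < u p)) ∧ ∀ q ∈ L, l q ≤ t ∧ (s q → l q < t) := by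
  by_cases hlt : ∀ p ∈ U, ∀ q ∈ L, l q < u p
  · obtain ⟨t, ht, ht'⟩ := Order.exists_between_finsets (hL.image l).toFinset (hU.image u).toFinset
      (by simpa using fun q hq p hp => hlt p hp q hq)
    simp only [Set.Finite.mem_toFinset, Set.forall_mem_image] at ht ht'
    exact ⟨t, fun p hp => ⟨(ht' hp).le, fun _ => ht' hp⟩, fun q hq => ⟨(ht hq).le, fun _ => ht hq⟩⟩
  -- Some upper bound `u p` does not exceed some lower bound `l q`; then `l q` itself meets all the
  -- bounds.
  · push Not at hlt
    obtain ⟨p, hp, q, hq, hpq⟩ := hlt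
    refine ⟨l q, fun p' hp' => ⟨(h p' hp' q hq).1, fun hs => (h p' hp' q hq).2 (Or.inl hs)⟩,
      fun q' hq' => ⟨((h p hp q' hq').1).trans hpq, fun hs =>
        ((h p hp q' hq').2 (Or.inr hs)).trans_le hpq⟩⟩

/-- Motzkin's transposition theorem over a divisible ordered abelian group: a finite system of
affine inequalities without solution implies a contradictory inequality between constants. -/
theorem exists_affineSat_or_contradiction [Nontrivial M]
    (hdiv : ∀ m : ℕ, m ≠ 0 → ∀ a : M, ∃ b : M, m • b = a) (n : ℕ)
    (S : Set (((Fin n → ℤ) × M) × ℕ)) (hS : S.Finite) :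
    (∃ x, ∀ c ∈ S, AffineSat c x) ∨
      ∃ c ∈ AddSubmonoid.closure S, c.1.1 = 0 ∧ (0 < c.1.2 ∨ 0 < c.2 ∧ 0 ≤ c.1.2) := by
  have : DenselyOrdered M := by
    refine ⟨fun a b hab => ?_⟩
    obtain ⟨d, hd⟩ := hdiv 2 two_ne_zero (b - a)
    have hd0 : 0 < d := by
      by_contra hd'
      have := nsmul_nonpos (not_lt.1 hd') 2
      rw [hd] at this
      exact absurd (sub_pos.2 hab) this.not_gt
    refine ⟨a + d, lt_add_of_pos_right a hd0, ?_⟩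
    have : b = a + d + d := by rw [add_assoc, ← two_nsmul, hd]; abel
    rw [this]
    exact lt_add_of_pos_right _ hd0
  induction n with
  | zero =>
    -- Without variables every inequality is between constants, and a violated one is itself the
    -- contradiction.
    by_cases h : ∀ c ∈ S, AffineSat c 0
    · exact Or.inl ⟨0, h⟩
    · push Not at h
      obtain ⟨c, hc, hcs⟩ := h
      refine Or.inr ⟨c, AddSubmonoid.subset_closure hc, Subsingleton.elim _ _, ?_⟩
      simp only [AffineSat, affineEval, Finset.univ_eq_empty, Finset.sum_empty, zero_add,
        not_and_or, Classical.not_imp, not_le, not_lt] at hcs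
      exact hcs
  | succ n ih =>
    set U : Set (((Fin (n + 1) → ℤ) × M) × ℕ) := {c ∈ S | 0 < c.1.1 0} with hUdef
    set L : Set (((Fin (n + 1) → ℤ) × M) × ℕ) := {c ∈ S | c.1.1 0 < 0} with hLdef
    set Z : Set (((Fin (n + 1) → ℤ) × M) × ℕ) := {c ∈ S | c.1.1 0 = 0} with hZdef
    have hU : U.Finite := hS.subset (Set.sep_subset _ _)
    have hL : L.Finite := hS.subset (Set.sep_subset _ _)
    have hZ : Z.Finite := hS.subset (Set.sep_subset _ _)
    set S' := affineTail '' (Z ∪ Set.image2 affineElim U L) with hS'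
    have hS'fin : S'.Finite := (hZ.union (hU.image2 _ hL)).image _
    -- Elimination only forms natural-number combinations, so a contradiction derived from `S'` is
    -- one derived from `S`.
    have hle : AddSubmonoid.closure S' ≤ (AddSubmonoid.closure S).comap affineLift := by
      rw [AddSubmonoid.closure_le]
      rintro _ ⟨c, hc | ⟨p, hp, q, hq, rfl⟩, rfl⟩
      · rw [SetLike.mem_coe, AddSubmonoid.mem_comap, affineLift_affineTail hc.2]
        exact AddSubmonoid.subset_closure hc.1
      · rw [SetLike.mem_coe, AddSubmonoid.mem_comap,
          affineLift_affineTail (affineElim_zero hp.2 hq.2)]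
        exact add_mem (nsmul_mem (AddSubmonoid.subset_closure hp.1) _)
          (nsmul_mem (AddSubmonoid.subset_closure hq.1) _)
    rcases ih S' hS'fin with ⟨x, hx⟩ | ⟨c, hc, hc0, hcon⟩
    swap
    · refine Or.inr ⟨affineLift c, hle hc, ?_, hcon⟩
      funext j
      refine Fin.cases ?_ (fun j => ?_) j <;> simp [affineLift, hc0]
    left
    -- Dividing by the absolute slope solves for the first variable `t`: members of `U` say `t ≤ -b
    -- p`, members of `L` say `b q ≤ t`. The value 0 at slope zero is a dummy.
    have hb : ∀ c : ((Fin (n + 1) → ℤ) × M) × ℕ, ∃ b : M, c.1.1 0 ≠ 0 →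
        (c.1.1 0).natAbs • b = affineEval (affineTail c).1 x := by
      intro c
      by_cases h : c.1.1 0 = 0
      · exact ⟨0, fun h' => absurd h h'⟩
      · obtain ⟨b, hb⟩ := hdiv (c.1.1 0).natAbs (by simpa using h) (affineEval (affineTail c).1 x)
        exact ⟨b, fun _ => hb⟩
    choose b hb using hb
    have hUeval : ∀ p ∈ U, ∀ t, affineEval p.1 (Fin.cons t x) = (p.1.1 0).natAbs • (t + b p) := by
      intro p hp t
      rw [affineEval_cons, nsmul_add, hb p hp.2.ne', ← natCast_zsmul t, Int.natCast_natAbs,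
        abs_of_pos hp.2]
      rfl
    have hLeval : ∀ q ∈ L, ∀ t, affineEval q.1 (Fin.cons t x) = (q.1.1 0).natAbs • (b q - t) := by
      intro q hq t
      rw [affineEval_cons, nsmul_sub, hb q hq.2.ne, ← natCast_zsmul t, Int.natCast_natAbs,
        abs_of_neg hq.2, neg_smul, sub_neg_eq_add, add_comm]
      rfl
    have hUpos : ∀ p ∈ U, (p.1.1 0).natAbs ≠ 0 := fun p hp => by
      simpa using hp.2.ne'
    have hLpos : ∀ p ∈ L, (p.1.1 0).natAbs ≠ 0 := fun p hp => by
      simpa using hp.2.ne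
    -- At `x` the eliminated inequality is a positive multiple of `b p + b q`, so it says exactly
    -- that the two bounds are consistent.
    have hpair : ∀ p ∈ U, ∀ q ∈ L, b q ≤ -b p ∧ (0 < p.2 ∨ 0 < q.2 → b q < -b p) := by
      intro p hp q hq
      have hsat := hx _ (Set.mem_image_of_mem affineTail (Or.inr (Set.mem_image2_of_mem hp hq)))
      have hn1 : (-q.1.1 0).toNat = (q.1.1 0).natAbs := by have := hq.2; omega
      have hn2 : (p.1.1 0).toNat = (p.1.1 0).natAbs := by have := hp.2; omega
      have hev : affineEval (affineTail (affineElim p q)).1 x =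
          ((q.1.1 0).natAbs * (p.1.1 0).natAbs) • (b p + b q) := by
        have h1 : affineEval (affineElim p q).1 (Fin.cons 0 x) =
            affineEval (affineTail (affineElim p q)).1 x := by
          rw [affineEval_cons, affineElim_zero hp.2 hq.2, zero_smul, zero_add]
          rfl
        rw [← h1]
        simp only [affineElim, Prod.fst_add, Prod.smul_fst, affineEval_add, affineEval_nsmul]
        rw [hUeval p hp, hLeval q hq, hn1, hn2, zero_add, sub_zero, nsmul_add, mul_nsmul',
          mul_nsmul', ← mul_nsmul' (b q), ← mul_nsmul' (b q), mul_comm (p.1.1 0).natAbs]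
      have hs : (affineTail (affineElim p q)).2 =
          (q.1.1 0).natAbs * p.2 + (p.1.1 0).natAbs * q.2 := by
        simp [affineTail, affineElim, hn1, hn2]
      have hne := mul_ne_zero (hLpos q hq) (hUpos p hp)
      rw [AffineSat, hev, hs] at hsat
      rw [le_neg_iff_add_nonpos_left, lt_neg_iff_add_neg']
      refine ⟨?_, fun h => ?_⟩
      · exact (nsmul_nonpos_iff hne).1 hsat.1
      · refine (nsmul_neg_iff hne).1 (hsat.2 ?_)
        rcases h with h | h
        · exact Nat.add_pos_left (Nat.mul_pos (Nat.pos_of_ne_zero (hLpos q hq)) h) _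
        · exact Nat.add_pos_right _ (Nat.mul_pos (Nat.pos_of_ne_zero (hUpos p hp)) h)
    obtain ⟨t, htU, htL⟩ := exists_between_of_pairwise hU hL (fun p => -b p) b (fun c => 0 < c.2)
      hpair
    refine ⟨Fin.cons t x, fun c hc => ?_⟩
    rcases lt_trichotomy (c.1.1 0) 0 with h | h | h
    · have hcL : c ∈ L := ⟨hc, h⟩
      rw [AffineSat, hLeval c hcL, nsmul_nonpos_iff (hLpos c hcL), nsmul_neg_iff (hLpos c hcL),
        sub_nonpos, sub_neg]
      exact htL c hcL
    · have := hx _ (Set.mem_image_of_mem affineTail (Or.inl ⟨hc, h⟩))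
      rw [AffineSat, affineEval_cons, h, zero_smul, zero_add]
      exact this
    · have hcU : c ∈ U := ⟨hc, h⟩
      rw [AffineSat, hUeval c hcU, nsmul_nonpos_iff (hUpos c hcU), nsmul_neg_iff (hUpos c hcU),
        ← le_neg_iff_add_nonpos_right, ← lt_neg_iff_add_neg]
      exact htU c hcU

end FourierMotzkin
-- Domination between piecewise affine functions
section PiecewiseAffine

variable {M : Type*} [AddCommGroup M] [LinearOrder M] {n : ℕ}

/-- A function is piecewise affine if finitely many pieces, each cut out by finitely many affine
inequalities and carrying an affine function, cover the space. A piece is a pair consisting of the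
affine function and the set of inequalities. -/
def IsPiecewiseAffine (F : (Fin n → M) → M) : Prop :=
  ∃ s : Set (((Fin n → ℤ) × M) × Set ((Fin n → ℤ) × M)), s.Finite ∧ (∀ p ∈ s, p.2.Finite) ∧
    (∀ x, ∃ p ∈ s, ∀ g ∈ p.2, affineEval g x ≤ 0) ∧
    ∀ p ∈ s, ∀ x, (∀ g ∈ p.2, affineEval g x ≤ 0) → F x = affineEval p.1 x

theorem IsPiecewiseAffine.sub {F G : (Fin n → M) → M} (hF : IsPiecewiseAffine F)
    (hG : IsPiecewiseAffine G) : IsPiecewiseAffine fun x => F x - G x := by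
  obtain ⟨s, hs, hs', hsc, hsF⟩ := hF
  obtain ⟨t, ht, ht', htc, htG⟩ := hG
  refine ⟨Set.image2 (fun p q => (p.1 - q.1, p.2 ∪ q.2)) s t, hs.image2 _ ht, ?_, ?_, ?_⟩
  · rintro _ ⟨p, hp, q, hq, rfl⟩
    exact (hs' p hp).union (ht' q hq)
  · intro x
    obtain ⟨p, hp, hpx⟩ := hsc x
    obtain ⟨q, hq, hqx⟩ := htc x
    exact ⟨_, Set.mem_image2_of_mem hp hq, fun g hg => hg.elim (hpx g) (hqx g)⟩
  · rintro _ ⟨p, hp, q, hq, rfl⟩ x hx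
    simp only [affineEval_sub]
    rw [hsF p hp x fun g hg => hx g (Or.inl hg), htG q hq x fun g hg => hx g (Or.inr hg)]

variable [IsOrderedAddMonoid M]

/-- The piece of index `i` is the region where the `i`-th affine function attains the maximum. -/
theorem IsPiecewiseAffine.sup' {ι : Type*} (s : Finset ι) (hs : s.Nonempty)
    (a : ι → (Fin n → ℤ) × M) :
    IsPiecewiseAffine fun x => s.sup' hs fun i => affineEval (a i) x := by
  refine ⟨(fun i => (a i, (fun j => a j - a i) '' s)) '' s, s.finite_toSet.image _, ?_, ?_, ?_⟩
  · rintro _ ⟨i, -, rfl⟩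
    exact s.finite_toSet.image _
  · intro x
    obtain ⟨i, hi, hi'⟩ := Finset.exists_mem_eq_sup' hs fun i => affineEval (a i) x
    refine ⟨_, Set.mem_image_of_mem _ hi, ?_⟩
    rintro _ ⟨j, hj, rfl⟩
    rw [affineEval_sub, sub_nonpos, ← hi']
    exact Finset.le_sup' (fun i => affineEval (a i) x) hj
  · rintro _ ⟨i, hi, rfl⟩ x hx
    refine le_antisymm (Finset.sup'_le _ _ fun j hj => ?_)
      (Finset.le_sup' (fun i => affineEval (a i) x) hi)
    have := hx _ (Set.mem_image_of_mem _ hj)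
    rwa [affineEval_sub, sub_nonpos] at this

/-- A bounded affine function that is nonnegative on a polyhedron and vanishes there wherever the
nonnegative affine function `b` does is bounded by a multiple of `b`. -/
theorem exists_affineEval_le_nsmul [Nontrivial M] [Archimedean M]
    (hdiv : ∀ m : ℕ, m ≠ 0 → ∀ a : M, ∃ b : M, m • b = a) (G : Set ((Fin n → ℤ) × M))
    (hG : G.Finite) (a b : (Fin n → ℤ) × M) (C : M)
    (ha : ∀ x, (∀ g ∈ G, affineEval g x ≤ 0) → 0 ≤ affineEval a x ∧ affineEval a x ≤ C)
    (hab : ∀ x, (∀ g ∈ G, affineEval g x ≤ 0) → affineEval b x ≤ 0 → affineEval a x ≤ 0) :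
    ∃ m : ℕ, ∀ x, (∀ g ∈ G, affineEval g x ≤ 0) → 0 ≤ affineEval b x →
      affineEval a x ≤ m • affineEval b x := by
  -- The tag 1 makes `-a < 0` strict. A solution would contradict `hab`.
  let S : Set (((Fin n → ℤ) × M) × ℕ) := (fun g => (g, 0)) '' G ∪ {(b, 0), (-a, 1)}
  have hS : S.Finite := (hG.image _).union (by simp)
  rcases exists_affineSat_or_contradiction hdiv n S hS with ⟨x, hx⟩ | ⟨c, hc, hc0, hcon⟩
  · have h1 := hab x (fun g hg => (hx (g, 0) (Or.inl ⟨g, hg, rfl⟩)).1)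
      (hx (b, 0) (Or.inr (by simp))).1
    have h2 := (hx (-a, 1) (Or.inr (by simp))).2 one_pos
    rw [affineEval_neg, neg_lt_zero] at h2
    exact absurd h1 h2.not_ge
  -- `μ` and `ν` count the uses of `b` and `-a`; the terms from `G` are nonpositive on the
  -- polyhedron and are dropped.
  have key : ∀ c ∈ AddSubmonoid.closure S, ∃ μ ν : ℕ, (0 < c.2 → 0 < ν) ∧
      ∀ x, (∀ g ∈ G, affineEval g x ≤ 0) →
        affineEval c.1 x ≤ μ • affineEval b x - ν • affineEval a x := by
    intro c hc
    induction hc using AddSubmonoid.closure_induction with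
    | mem c hc =>
      rcases hc with ⟨g, hg, rfl⟩ | rfl | rfl
      · exact ⟨0, 0, by simp, fun x hx => by simpa using hx g hg⟩
      · exact ⟨1, 0, by simp, fun x hx => by simp⟩
      · exact ⟨0, 1, by simp, fun x hx => by simp [affineEval_neg]⟩
    | zero => exact ⟨0, 0, by simp, fun x hx => by simp [affineEval]⟩
    | add c d _ _ hc hd =>
      obtain ⟨μ, ν, h, hle⟩ := hc
      obtain ⟨μ', ν', h', hle'⟩ := hd
      refine ⟨μ + μ', ν + ν', fun hs => ?_, fun x hx => ?_⟩
      · rw [Prod.snd_add] at hs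
        omega
      · rw [Prod.fst_add, affineEval_add, add_nsmul, add_nsmul, add_sub_add_comm]
        exact add_le_add (hle x hx) (hle' x hx)
  obtain ⟨μ, ν, hν, hle⟩ := key c hc
  have hval : ∀ x, affineEval c.1 x = c.1.2 := fun x => by simp [affineEval, hc0]
  simp only [hval] at hle
  -- If `ν = 0`, then `μ • b` is at least a positive constant, a multiple of which exceeds `C`.
  -- Otherwise `a ≤ ν • a ≤ μ • b`.
  rcases Nat.eq_zero_or_pos ν with rfl | hν0
  · have hpos : 0 < c.1.2 := hcon.resolve_right fun h => (hν h.1).false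
    obtain ⟨N, hN⟩ := Archimedean.arch C hpos
    refine ⟨N * μ, fun x hx _ => (ha x hx).2.trans (hN.trans ?_)⟩
    rw [mul_nsmul']
    exact nsmul_le_nsmul_right (by simpa using hle x hx) N
  · refine ⟨μ, fun x hx _ => ?_⟩
    have hc0' : 0 ≤ c.1.2 := hcon.elim le_of_lt And.right
    have h1 := sub_nonneg.1 (hc0'.trans (hle x hx))
    refine le_trans ?_ h1
    simpa using nsmul_le_nsmul_left (ha x hx).1 hν0

/-- Both functions are affine on each intersection of a piece of `F` with a piece of `H`; the
largest of the finitely many multipliers works everywhere because `H ≥ 0`. -/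
theorem IsPiecewiseAffine.exists_le_nsmul [Nontrivial M] [Archimedean M]
    (hdiv : ∀ m : ℕ, m ≠ 0 → ∀ a : M, ∃ b : M, m • b = a) {F H : (Fin n → M) → M}
    (hF : IsPiecewiseAffine F) (hH : IsPiecewiseAffine H) (C : M) (hF0 : ∀ x, 0 ≤ F x)
    (hFC : ∀ x, F x ≤ C) (hH0 : ∀ x, 0 ≤ H x) (hz : ∀ x, H x = 0 → F x = 0) :
    ∃ m : ℕ, ∀ x, F x ≤ m • H x := by
  obtain ⟨s, hs, hs', hsc, hsF⟩ := hF
  obtain ⟨t, ht, ht', htc, htH⟩ := hH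
  have key : ∀ r : (((Fin n → ℤ) × M) × Set ((Fin n → ℤ) × M)) ×
      (((Fin n → ℤ) × M) × Set ((Fin n → ℤ) × M)), ∃ m : ℕ, r ∈ s ×ˢ t →
      ∀ x, (∀ g ∈ r.1.2 ∪ r.2.2, affineEval g x ≤ 0) → F x ≤ m • H x := by
    rintro ⟨p, q⟩
    by_cases h : p ∈ s ∧ q ∈ t
    swap
    · exact ⟨0, fun h' => absurd h' h⟩
    obtain ⟨hp, hq⟩ := h
    have h1 : ∀ x, (∀ g ∈ p.2 ∪ q.2, affineEval g x ≤ 0) → F x = affineEval p.1 x :=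
      fun x hx => hsF p hp x fun g hg => hx g (Or.inl hg)
    have h2 : ∀ x, (∀ g ∈ p.2 ∪ q.2, affineEval g x ≤ 0) → H x = affineEval q.1 x :=
      fun x hx => htH q hq x fun g hg => hx g (Or.inr hg)
    obtain ⟨m, hm⟩ := exists_affineEval_le_nsmul hdiv (p.2 ∪ q.2) ((hs' p hp).union (ht' q hq))
      p.1 q.1 C (fun x hx => by rw [← h1 x hx]; exact ⟨hF0 x, hFC x⟩) (fun x hx hx' => by
        rw [← h2 x hx] at hx'
        rw [← h1 x hx, hz x (le_antisymm hx' (hH0 x))])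
    refine ⟨m, fun _ x hx => ?_⟩
    rw [h1 x hx, h2 x hx]
    exact hm x hx (by rw [← h2 x hx]; exact hH0 x)
  choose m hm using key
  have hfin : (s ×ˢ t).Finite := hs.prod ht
  refine ⟨hfin.toFinset.sup m, fun x => ?_⟩
  obtain ⟨p, hp, hpx⟩ := hsc x
  obtain ⟨q, hq, hqx⟩ := htc x
  refine (hm (p, q) ⟨hp, hq⟩ x fun g hg => hg.elim (hpx g) (hqx g)).trans ?_
  exact nsmul_le_nsmul_left (hH0 x) (Finset.le_sup (f := m) (by simp [hp, hq]))

end PiecewiseAffine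

/-! ### From rational functions to piecewise affine ones -/

section Monomials

variable {R : Type*} [CommGroup R] [LinearOrder R] [IsOrderedMonoid R] {n : ℕ}

theorem IsPolynomialFun.isPiecewiseAffine {p : (Fin n → R) → R} (hp : IsPolynomialFun p) :
    IsPiecewiseAffine (M := Additive R) fun x => Additive.ofMul (p fun j => (x j).toMul) := by
  obtain ⟨s, hs, hp⟩ := hp
  convert IsPiecewiseAffine.sup' (M := Additive R) s hs
    (fun m => (fun j => (m.2 j : ℤ), Additive.ofMul m.1)) using 2 with x
  rw [hp]
  have : ∀ m : R × (Fin n → ℕ), affineEval (M := Additive R)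
      (fun j => (m.2 j : ℤ), Additive.ofMul m.1) x =
        Additive.ofMul (monomialFun m.1 m.2 fun j => (x j).toMul) := by
    intro m
    simp [affineEval, monomialFun, ofMul_mul, ofMul_prod, add_comm]
  simp only [this]
  rfl

/-- A bounded rational function `f ≥ 1` that equals `1` wherever the rational function `h ≥ 1`
does is bounded by a power of `h`. -/
theorem RationalFun.exists_le_pow [MulArchimedean R]
    (hdiv : ∀ m : ℕ, m ≠ 0 → ∀ a : R, ∃ b : R, b ^ m = a) {f h : RationalFun R n}
    (hf1 : 1 ≤ f) (hh1 : 1 ≤ h) {α : R} (hfα : f ≤ RationalFun.const n α)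
    (hs : Skel {h} ⊆ Skel {f}) : ∃ m : ℕ, f ≤ h ^ m := by
  rcases subsingleton_or_nontrivial R with hR | hR
  · exact ⟨0, fun x => (Subsingleton.elim _ _).le⟩
  obtain ⟨f, p, q, hp, hq, rfl⟩ := f
  obtain ⟨h, p', q', hp', hq', rfl⟩ := h
  obtain ⟨m, hm⟩ := IsPiecewiseAffine.exists_le_nsmul (M := Additive R)
    (fun m hm a => hdiv m hm a)
    (hp.isPiecewiseAffine.sub hq.isPiecewiseAffine) (hp'.isPiecewiseAffine.sub hq'.isPiecewiseAffine)
    (Additive.ofMul α) (fun x => hf1 _) (fun x => hfα _) (fun x => hh1 _) (fun x hx => by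
      have hx' : (fun j => (x j).toMul) ∈ Skel {(⟨p' / q', p', q', hp', hq', rfl⟩ :
          RationalFun R n)} := by
        rintro _ rfl
        exact hx
      exact hs hx' _ rfl)
  exact ⟨m, fun x => hm fun j => Additive.ofMul (x j)⟩

end Monomials
-- Kernels as order-convex subgroups
section GeneratedKernels

variable {S : Type*} [CommGroup S] [SemilatticeSup S]

/-- The sum of `a`, `a⁻¹` and `1`. It generates the same kernel as `a`. -/
def supInvSupOne (a : S) : S := a ⊔ a⁻¹ ⊔ 1

theorem le_supInvSupOne (a : S) : a ≤ supInvSupOne a := le_sup_left.trans le_sup_left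

theorem inv_le_supInvSupOne (a : S) : a⁻¹ ≤ supInvSupOne a := le_sup_right.trans le_sup_left

theorem one_le_supInvSupOne (a : S) : 1 ≤ supInvSupOne a := le_sup_right

variable [IsOrderedMonoid S]

theorem SemifieldKernel.subset_generate (A : Set S) : A ⊆ SemifieldKernel.generate A :=
  fun _ ha _ hK => hK ha

theorem SemifieldKernel.generate_le {A : Set S} {K : SemifieldKernel S} (h : A ⊆ (K : Set S)) :
    (SemifieldKernel.generate A : Set S) ⊆ K :=
  fun _ ha => ha K h

theorem SemifieldKernel.sup_mem (K : SemifieldKernel S) {a b : S} (ha : a ∈ K) (hb : b ∈ K) :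
    a ⊔ b ∈ K :=
  K.toSubsemifield.sup_mem' ha hb

theorem SemifieldKernel.mul_mem (K : SemifieldKernel S) {a b : S} (ha : a ∈ K) (hb : b ∈ K) :
    a * b ∈ K :=
  K.mul_mem' ha hb

theorem SemifieldKernel.inv_mem (K : SemifieldKernel S) {a : S} (ha : a ∈ K) : a⁻¹ ∈ K :=
  K.inv_mem' ha

theorem SemifieldKernel.one_mem (K : SemifieldKernel S) : 1 ∈ K :=
  K.one_mem'

theorem SemifieldKernel.pow_mem (K : SemifieldKernel S) {a : S} (ha : a ∈ K) (m : ℕ) :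
    a ^ m ∈ K :=
  K.toSubgroup.pow_mem ha m

/-- Kernels are order-convex. -/
theorem SemifieldKernel.mem_of_le_of_inv_le (K : SemifieldKernel S) {a b : S} (hb : b ∈ K)
    (h : a ≤ b) (h' : a⁻¹ ≤ b) : a ∈ K := by
  -- Write `c = (c * d⁻¹) * d ⊔ 1 * 1`, where `c * d⁻¹ ⊔ 1 = 1`. Below this is applied to `1 ≤ a * b
  -- ≤ b * b`.
  have key : ∀ c d : S, d ∈ K → 1 ≤ c → c ≤ d → c ∈ K := by
    intro c d hd hc hcd
    have hx : c * d⁻¹ ⊔ 1 = 1 := sup_eq_right.2 (by simpa using hcd)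
    have := K.convex' hx hd K.one_mem
    rwa [inv_mul_cancel_right, mul_one, sup_eq_left.2 hc] at this
  have h1 : a * b ∈ K :=
    key _ (b * b) (K.mul_mem hb hb) (by simpa using mul_le_mul_right h' a)
      (mul_le_mul_left h b)
  simpa using K.mul_mem h1 (K.inv_mem hb)

theorem SemifieldKernel.supInvSupOne_mem (K : SemifieldKernel S) {a : S} (ha : a ∈ K) :
    supInvSupOne a ∈ K :=
  K.sup_mem (K.sup_mem ha (K.inv_mem ha)) K.one_mem

/-- The order-convex subgroup of all elements bounded by a member of a directed family. -/
def SemifieldKernel.bounded (B : Set S) (h1 : ∃ b ∈ B, 1 ≤ b)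
    (hmul : ∀ b ∈ B, ∀ c ∈ B, b * c ∈ B)
    (hdir : ∀ b ∈ B, ∀ c ∈ B, ∃ d ∈ B, b ≤ d ∧ c ≤ d) : SemifieldKernel S where
  carrier := {a | ∃ b ∈ B, a ≤ b ∧ a⁻¹ ≤ b}
  mul_mem' := by
    rintro a a' ⟨b, hb, h, h'⟩ ⟨c, hc, k, k'⟩
    exact ⟨b * c, hmul b hb c hc, mul_le_mul' h k, by rw [mul_inv]; exact mul_le_mul' h' k'⟩
  one_mem' := by
    obtain ⟨b, hb, h⟩ := h1
    exact ⟨b, hb, h, by simpa using h⟩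
  inv_mem' := by
    rintro a ⟨b, hb, h, h'⟩
    exact ⟨b, hb, h', by simpa using h⟩
  convex' := by
    rintro x y a a' hxy ⟨b, hb, h, h'⟩ ⟨c, hc, k, k'⟩
    obtain ⟨d, hd, hbd, hcd⟩ := hdir b hb c hc
    refine ⟨d, hd, sup_le ?_ ?_, ?_⟩
    · exact (mul_le_mul' (le_sup_left.trans hxy.le) (h.trans hbd)).trans (one_mul d).le
    · exact (mul_le_mul' (le_sup_right.trans hxy.le) (k.trans hcd)).trans (one_mul d).le
    -- The inverse is bounded by `d` because `x` and `y`, hence `1 = x ⊔ y`, lie below `(x * a ⊔ y *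
    -- a') * d`.
    · have e1 : x ≤ (x * a ⊔ y * a') * d :=
        calc x = x * a * a⁻¹ := by simp
          _ ≤ _ := mul_le_mul' le_sup_left (h'.trans hbd)
      have e2 : y ≤ (x * a ⊔ y * a') * d :=
        calc y = y * a' * a'⁻¹ := by simp
          _ ≤ _ := mul_le_mul' le_sup_right (k'.trans hcd)
      have e3 := sup_le e1 e2
      rw [hxy] at e3
      exact inv_le_iff_one_le_mul'.2 e3

/-- The powers of `supInvSupOne f` form an increasing chain in the kernel, and the elements they
bound already form a kernel containing `f`. -/
theorem SemifieldKernel.mem_generate_singleton {f g : S} :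
    g ∈ SemifieldKernel.generate {f} ↔
      ∃ m : ℕ, g ≤ supInvSupOne f ^ m ∧ g⁻¹ ≤ supInvSupOne f ^ m := by
  constructor
  · intro hg
    have hf := one_le_supInvSupOne f
    obtain ⟨_, ⟨m, rfl⟩, h⟩ := hg (SemifieldKernel.bounded (Set.range (supInvSupOne f ^ · : ℕ → S))
      ⟨_, ⟨0, rfl⟩, by simp⟩ (by rintro _ ⟨k, rfl⟩ _ ⟨l, rfl⟩; exact ⟨k + l, pow_add _ _ _⟩)
      (by
        rintro _ ⟨k, rfl⟩ _ ⟨l, rfl⟩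
        exact ⟨_, ⟨max k l, rfl⟩, pow_le_pow_right' hf (le_max_left k l),
          pow_le_pow_right' hf (le_max_right k l)⟩))
      (Set.singleton_subset_iff.2
        ⟨_, ⟨1, rfl⟩, by simpa using le_supInvSupOne f, by simpa using inv_le_supInvSupOne f⟩)
    exact ⟨m, h⟩
  · rintro ⟨m, h, h'⟩
    exact SemifieldKernel.mem_of_le_of_inv_le _ (SemifieldKernel.pow_mem _
      (SemifieldKernel.supInvSupOne_mem _
        (SemifieldKernel.subset_generate _ (Set.mem_singleton f))) m) h h'

theorem SemifieldKernel.generate_eq_of_mem {f h : S} (h1 : h ∈ SemifieldKernel.generate {f})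
    (h2 : f ∈ SemifieldKernel.generate {h}) :
    SemifieldKernel.generate {h} = SemifieldKernel.generate {f} :=
  SetLike.coe_injective (Set.Subset.antisymm
    (SemifieldKernel.generate_le (Set.singleton_subset_iff.2 h1))
    (SemifieldKernel.generate_le (Set.singleton_subset_iff.2 h2)))

end GeneratedKernels

/-! ### Skeletons and principal kernels of ⟨R⟩ -/

section Skeletons

variable {R : Type*} [CommGroup R] [LinearOrder R] [IsOrderedMonoid R] {n : ℕ}

theorem mem_Skel_singleton {f : RationalFun R n} {x : Fin n → R} :
    x ∈ Skel {f} ↔ (f : (Fin n → R) → R) x = 1 :=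
  ⟨fun h => h f rfl, by rintro h _ rfl; exact h⟩

theorem RationalFun.supInvSupOne_apply (f : RationalFun R n) (x : Fin n → R) :
    (supInvSupOne f : RationalFun R n).1 x = supInvSupOne (f.1 x) :=
  rfl

theorem supInvSupOne_eq_one {a : R} : supInvSupOne a = 1 ↔ a = 1 := by
  refine ⟨fun h => le_antisymm (h ▸ le_supInvSupOne a) ?_, ?_⟩
  · exact inv_le_one'.1 (h ▸ inv_le_supInvSupOne a)
  · rintro rfl
    simp [supInvSupOne]

theorem Skel_supInvSupOne (f : RationalFun R n) : Skel {supInvSupOne f} = Skel {f} := by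
  ext x
  rw [mem_Skel_singleton, mem_Skel_singleton, RationalFun.supInvSupOne_apply, supInvSupOne_eq_one]

theorem mem_constKernel_iff {f : RationalFun R n} :
    f ∈ constKernel R n ↔ ∃ α : R, f ≤ RationalFun.const n α ∧ f⁻¹ ≤ RationalFun.const n α := by
  constructor
  · intro hf
    obtain ⟨_, ⟨α, rfl⟩, h⟩ := hf (SemifieldKernel.bounded (Set.range (RationalFun.const n))
      ⟨_, ⟨1, rfl⟩, le_rfl⟩
      (by rintro _ ⟨k, rfl⟩ _ ⟨l, rfl⟩; exact ⟨k * l, rfl⟩)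
      (by
        rintro _ ⟨k, rfl⟩ _ ⟨l, rfl⟩
        exact ⟨_, ⟨max k l, rfl⟩, fun _ => le_max_left k l, fun _ => le_max_right k l⟩))
      (by
        rintro _ ⟨k, rfl⟩
        exact ⟨_, ⟨max k k⁻¹, rfl⟩, fun _ => le_max_left k k⁻¹, fun _ => le_max_right k k⁻¹⟩)
    exact ⟨α, h⟩
  · rintro ⟨α, h, h'⟩
    exact SemifieldKernel.mem_of_le_of_inv_le _
      (SemifieldKernel.subset_generate _ ⟨α, rfl⟩) h h'

/-- A bounded rational function is dominated by a power of any rational function with a smaller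
skeleton. -/
theorem RationalFun.exists_le_supInvSupOne_pow [MulArchimedean R]
    (hdiv : ∀ m : ℕ, m ≠ 0 → ∀ a : R, ∃ b : R, b ^ m = a) {f h : RationalFun R n}
    (hf : f ∈ constKernel R n) (hs : Skel {h} ⊆ Skel {f}) :
    ∃ m : ℕ, f ≤ supInvSupOne h ^ m ∧ f⁻¹ ≤ supInvSupOne h ^ m := by
  obtain ⟨α, hα, -⟩ := mem_constKernel_iff.1 (SemifieldKernel.supInvSupOne_mem _ hf)
  obtain ⟨m, hm⟩ := RationalFun.exists_le_pow hdiv (one_le_supInvSupOne f) (one_le_supInvSupOne h)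
    hα (by rwa [Skel_supInvSupOne, Skel_supInvSupOne])
  exact ⟨m, (le_supInvSupOne f).trans hm, (inv_le_supInvSupOne f).trans hm⟩

/-- The elementary direction: where `h` is 1, so is every power of `supInvSupOne h`, which squeezes
`f`. -/
theorem Skel_subset_of_mem_generate {f h : BoundedFun R n}
    (hf : f ∈ SemifieldKernel.generate {h}) :
    Skel {(h : RationalFun R n)} ⊆ Skel {(f : RationalFun R n)} := by
  obtain ⟨m, h1, h2⟩ := SemifieldKernel.mem_generate_singleton.1 hf
  intro x hx
  rw [← Skel_supInvSupOne] at hx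
  have hx1 : (supInvSupOne (h : RationalFun R n)).1 x ^ m = 1 := by
    rw [mem_Skel_singleton.1 hx, one_pow]
  have e1 : (f : RationalFun R n).1 x ≤ (supInvSupOne (h : RationalFun R n)).1 x ^ m := h1 x
  have e2 : ((f : RationalFun R n).1 x)⁻¹ ≤ (supInvSupOne (h : RationalFun R n)).1 x ^ m := h2 x
  rw [hx1] at e1 e2
  exact mem_Skel_singleton.2 (le_antisymm e1 (inv_le_one'.1 e2))

theorem BoundedFun.mem_generate_iff [MulArchimedean R]
    (hdiv : ∀ m : ℕ, m ≠ 0 → ∀ a : R, ∃ b : R, b ^ m = a) {f h : BoundedFun R n} :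
    f ∈ SemifieldKernel.generate {h} ↔
      Skel {(h : RationalFun R n)} ⊆ Skel {(f : RationalFun R n)} := by
  refine ⟨Skel_subset_of_mem_generate, fun hs => ?_⟩
  -- The order and operations of ⟨R⟩ are inherited, so the bound found among rational functions is
  -- the bound required in ⟨R⟩.
  exact SemifieldKernel.mem_generate_singleton.2
    (RationalFun.exists_le_supInvSupOne_pow hdiv f.2 hs)

theorem BoundedFun.coe_generate [MulArchimedean R]
    (hdiv : ∀ m : ℕ, m ≠ 0 → ∀ a : R, ∃ b : R, b ^ m = a) (h : BoundedFun R n) :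
    (SemifieldKernel.generate {h} : Set (BoundedFun R n)) =
      boundedKer (Skel {(h : RationalFun R n)}) := by
  ext f
  rw [SetLike.mem_coe, BoundedFun.mem_generate_iff hdiv]
  exact ⟨fun hs x hx => mem_Skel_singleton.1 (hs hx), fun hs x hx => mem_Skel_singleton.2 (hs x hx)⟩

theorem kernelSkel_generate (h : BoundedFun R n) :
    kernelSkel (SemifieldKernel.generate {h}) = Skel {(h : RationalFun R n)} := by
  refine Set.Subset.antisymm (fun x hx => ?_) (fun x hx => ?_)
  · exact mem_Skel_singleton.2 (hx _ ⟨h, SemifieldKernel.subset_generate _ rfl, rfl⟩)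
  · rintro _ ⟨f, hf, rfl⟩
    exact mem_Skel_singleton.1 (Skel_subset_of_mem_generate hf hx)

theorem isPrincipalSkeleton_kernelSkel {K : SemifieldKernel (BoundedFun R n)}
    (hK : K.IsPrincipal) : IsPrincipalSkeleton (kernelSkel K) := by
  obtain ⟨h, rfl⟩ := hK
  exact ⟨h, kernelSkel_generate h⟩

/-- Truncation at a constant: each principal skeleton is the skeleton of a bounded function. -/
theorem IsPrincipalSkeleton.exists_boundedFun {Z : Set (Fin n → R)} (hZ : IsPrincipalSkeleton Z) :
    ∃ f : BoundedFun R n, Z = Skel {(f : RationalFun R n)} := by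
  obtain ⟨f, rfl⟩ := hZ
  rcases subsingleton_or_nontrivial R with hR | hR
  · exact ⟨1, Set.ext fun x => by simp only [mem_Skel_singleton, eq_iff_true_of_subsingleton]⟩
  obtain ⟨α, hα⟩ := exists_one_lt' (α := R)
  -- The minimum of `supInvSupOne f` and `α`, written with inverses and joins. Since `α > 1`, it
  -- equals 1 exactly where `f` does.
  set g : RationalFun R n := ((supInvSupOne f)⁻¹ ⊔ (RationalFun.const n α)⁻¹)⁻¹ with hg
  have hgx : ∀ x, g.1 x = min (supInvSupOne (f.1 x)) α := fun x => by
    change (max (supInvSupOne (f.1 x))⁻¹ α⁻¹)⁻¹ = _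
    rw [max_inv_inv', inv_inv]
  have hmem : g ∈ constKernel R n := by
    refine mem_constKernel_iff.2 ⟨α, fun x => ?_, fun x => ?_⟩
    · exact (hgx x).trans_le (min_le_right _ _)
    · change (g.1 x)⁻¹ ≤ α
      rw [hgx]
      exact (inv_le_one'.2 (le_min (one_le_supInvSupOne _) hα.le)).trans hα.le
  refine ⟨⟨g, hmem⟩, Set.ext fun x => ?_⟩
  rw [mem_Skel_singleton, mem_Skel_singleton, hgx, ← supInvSupOne_eq_one]
  refine ⟨fun h => by rw [h, min_eq_left hα.le], fun h => ?_⟩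
  rcases min_choice (supInvSupOne (f.1 x)) α with h' | h'
  · rw [← h', h]
  · exact absurd (h'.symm.trans h) hα.ne'

/-- The correspondence between principal skeletons and principal kernels of `⟨R⟩`. -/
noncomputable def skeletonEquivKernel [MulArchimedean R]
    (hdiv : ∀ m : ℕ, m ≠ 0 → ∀ a : R, ∃ b : R, b ^ m = a) (n : ℕ) :
    {Z : Set (Fin n → R) // IsPrincipalSkeleton Z} ≃
      {K : SemifieldKernel (BoundedFun R n) // K.IsPrincipal} where
  -- The choice of generator is harmless: by `BoundedFun.coe_generate` the kernel depends only on
  -- `Z`.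
  toFun Z := ⟨SemifieldKernel.generate {Z.2.exists_boundedFun.choose}, _, rfl⟩
  invFun K := ⟨kernelSkel K.1, isPrincipalSkeleton_kernelSkel K.2⟩
  left_inv Z := Subtype.ext <|
    (kernelSkel_generate _).trans Z.2.exists_boundedFun.choose_spec.symm
  right_inv K := by
    obtain ⟨K, h, rfl⟩ := K
    refine Subtype.ext (SetLike.coe_injective ((BoundedFun.coe_generate hdiv _).trans ?_))
    rw [BoundedFun.coe_generate hdiv, ← kernelSkel_generate h]
    exact congrArg boundedKer
      (isPrincipalSkeleton_kernelSkel ⟨h, rfl⟩).exists_boundedFun.choose_spec.symm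

theorem coe_skeletonEquivKernel [MulArchimedean R]
    (hdiv : ∀ m : ℕ, m ≠ 0 → ∀ a : R, ∃ b : R, b ^ m = a)
    (Z : {Z : Set (Fin n → R) // IsPrincipalSkeleton Z}) :
    ((skeletonEquivKernel hdiv n Z).1 : Set (BoundedFun R n)) = boundedKer Z.1 := by
  refine (BoundedFun.coe_generate hdiv _).trans ?_
  rw [← Z.2.exists_boundedFun.choose_spec]

/-- A bounded function with skeleton `Z'` separates `Z'` from every point outside it, so only `Z'`
has to be principal. -/
theorem IsPrincipalSkeleton.subset_iff {Z Z' : Set (Fin n → R)} (hZ' : IsPrincipalSkeleton Z') :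
    Z ⊆ Z' ↔ (boundedKer Z' : Set (BoundedFun R n)) ⊆ boundedKer Z := by
  refine ⟨fun h f hf x hx => hf x (h hx), fun h x hx => ?_⟩
  obtain ⟨f, rfl⟩ := hZ'.exists_boundedFun
  exact mem_Skel_singleton.2 (h (a := f) (fun y hy => mem_Skel_singleton.1 hy) x hx)

end Skeletons

theorem mainTheorem3 {R : Type*} [CommGroup R] [ConditionallyCompleteLinearOrder R]
    [IsOrderedMonoid R] [MulArchimedean R]
    (hdiv : ∀ m : ℕ, m ≠ 0 → ∀ a : R, ∃ b : R, b ^ m = a) (n : ℕ) :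
    -- the order-reversing bijection, its formula and the formula of its inverse
    (∃ Φ : {Z : Set (Fin n → R) // IsPrincipalSkeleton Z} ≃
        {K : SemifieldKernel (BoundedFun R n) // K.IsPrincipal},
      (∀ Z, ((Φ Z).1 : Set (BoundedFun R n)) = boundedKer Z.1) ∧
      (∀ K, (Φ.symm K).1 = kernelSkel K.1) ∧
      (∀ Z Z', Z.1 ⊆ Z'.1 ↔ ((Φ Z').1 : Set (BoundedFun R n)) ⊆ ((Φ Z).1 : Set (BoundedFun R n)))) ∧
    -- an element of a principal kernel of `⟨R⟩` with the same skeleton is a generator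
    (∀ f h : BoundedFun R n, h ∈ SemifieldKernel.generate {f} →
      Skel {(h : RationalFun R n)} = Skel {(f : RationalFun R n)} →
      SemifieldKernel.generate {h} = SemifieldKernel.generate {f}) ∧
    -- the same for kernels of `R(x₁, …, xₙ)` that are contained in `⟨R⟩`
    (∀ f h : RationalFun R n,
      (SemifieldKernel.generate {f} : Set (RationalFun R n)) ⊆
        (constKernel R n : Set (RationalFun R n)) →
      h ∈ SemifieldKernel.generate {f} → Skel {h} = Skel {f} →
      SemifieldKernel.generate {h} = SemifieldKernel.generate {f}) := by
  refine ⟨⟨skeletonEquivKernel hdiv n, coe_skeletonEquivKernel hdiv, fun K => rfl,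
    fun Z Z' => ?_⟩, fun f h hf hs => ?_, fun f h hf hh hs => ?_⟩
  · rw [coe_skeletonEquivKernel, coe_skeletonEquivKernel]
    exact Z'.2.subset_iff
  · exact SemifieldKernel.generate_eq_of_mem hf ((BoundedFun.mem_generate_iff hdiv).2 hs.le)
  -- Only `f` has to be bounded for a power of `supInvSupOne h` to dominate it, and `f` lies in its
  -- own kernel, hence in ⟨R⟩.
  · exact SemifieldKernel.generate_eq_of_mem hh (SemifieldKernel.mem_generate_singleton.2
      (RationalFun.exists_le_supInvSupOne_pow hdiv
        (hf (SemifieldKernel.subset_generate _ rfl)) hs.le))
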